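/- Write $[a,b]=\{a,a+1,\dots,b\}$ and $[n]=[1,n]$. For $1\le j<i\le n$ the $ij$-shift of a family $\mathcal A\subseteq\binom{[n]}{r}$ replaces each $A\in\mathcal A$ with $i\in A$, $j\notin A$ by $(A\setminus\{i\})\cup\{j\}$ whenever the latter is not in $\mathcal A$; $\mathcal A$ is left-compressed if it is unchanged by every $ij$-shift with $i>j$, and intersecting if no two members are disjoint. An MLCIF is a left-compressed intersecting family $\mathcal A\subseteq\binom{[n]}{r}$ that is maximal under inclusion among such families. For $X\subseteq[n]$ let $\mathrm{hit}_X(\mathcal A)=|\{A\in\mathcal A: A\cap X\neq\emptyset\}|$; an MLCIF is optimal for $X$ if it maximises $\mathrm{hit}_X$ among all MLCIFs (for the given $n$ and $r$). Let $\mathcal S=\{A\in\binom{[n]}{r}:1\in A\}$ be the star and, for $t\in[n]$, let $$\mathrm{AHM}_t=\{A\in\mathcal S: A\cap[2,t]\ne\emptyset\}\cup\{A\in\tbinom{[n]}{r}:[2,t]\subseteq A\}.$$ Theorem. For every $r\ge 3$ there is an $N=N(r)$ such that for every $n\ge N$ and every nonempty $X\subseteq[2,n]$ the following hold. (a) If $X=\{2\}$,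 then $\mathrm{AHM}_3$ is the only optimal MLCIF for $X$. (b) If $|X|=2$ and $X\cap\{2,3\}\ne\emptyset$, then the optimal MLCIFs for $X$ are exactly $\mathrm{AHM}_3$ if $4\notin X$, and exactly $\mathrm{AHM}_3$ and $\mathrm{AHM}_4$ if $4\in X$. (c) If $|X|=3$ and $\{2,3\}\subseteq X$, then the optimal MLCIFs for $X$ are exactly $\mathrm{AHM}_3$ if $X\ne\{2,3,4\}$, and exactly $\mathrm{AHM}_3$ and $\mathrm{AHM}_4$ if $X=\{2,3,4\}$. (d) If $X\subseteq[2,r+1]$ and $X$ is not as in (a)–(c), then $\mathrm{AHM}_{\max X}$ is the only optimal MLCIF for $X$. (e) If $X$ is not as in (a)–(d), then $\mathcal S$ is the only optimal MLCIF for $X$. -/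

import Mathlib

open Finset

/-- The complete `r`-uniform family on `[n] = {1, …, n}`. -/
def uniformSets (n r : ℕ) : Finset (Finset ℕ) :=
  powersetCard r (Icc 1 n)

/-- A family of subsets of `[n]` is left-compressed if it is fixed by the `ij`-shift for all
`i > j` in `[n]`. `UV.compression {j} {i} F` is this shift: every member `A` of `F` with `i ∈ A` and
`j ∉ A` is replaced by `(A \ {i}) ∪ {j}`, unless the latter already belongs to `F`. -/
def LeftCompressed (n : ℕ) (F : Finset (Finset ℕ)) : Prop :=
  ∀ i ∈ Icc 1 n, ∀ j ∈ Icc 1 n, j < i → UV.compression {j} {i} F = F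

/-- Left-compressed intersecting families of `r`-subsets of `[n]`. -/
def IsLCIF (n r : ℕ) (F : Finset (Finset ℕ)) : Prop :=
  F ⊆ uniformSets n r ∧ LeftCompressed n F ∧ (F : Set (Finset ℕ)).Intersecting

/-- Maximal (with respect to inclusion) left-compressed intersecting families of `r`-subsets
of `[n]`. -/
def IsMLCIF (n r : ℕ) (F : Finset (Finset ℕ)) : Prop :=
  Maximal (IsLCIF n r) F

/-- The hitting of a family `F` with a set `X`: the number of members of `F` that meet `X`. -/
def hit (X : Finset ℕ) (F : Finset (Finset ℕ)) : ℕ :=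
  #{A ∈ F | (A ∩ X).Nonempty}

/-- `F` is an optimal maximal left-compressed intersecting family for `X`. -/
def IsOptimalFor (n r : ℕ) (X : Finset ℕ) (F : Finset (Finset ℕ)) : Prop :=
  IsMLCIF n r F ∧ ∀ F' : Finset (Finset ℕ), IsMLCIF n r F' → hit X F' ≤ hit X F

/-- The star at `1`. -/
def star1 (n r : ℕ) : Finset (Finset ℕ) :=
  {A ∈ uniformSets n r | 1 ∈ A}

/-- The `t`-adjusted Hilton-Milner family. -/
def AHM (n r t : ℕ) : Finset (Finset ℕ) :=
  {A ∈ star1 n r | (A ∩ Icc 2 t).Nonempty} ∪ {A ∈ uniformSets n r | Icc 2 t ⊆ A}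

/-! Two members of a left-compressed intersecting family always share an element of $[2r]$, so a
maximal such family $F$ contains every $r$-set above the trace of any member on $[2r]$
(`IsMLCIF.containsAbove_inter`). Shifting small traces down shows that a one-element trace forces
the star and a two-element trace avoiding 1 forces $\mathrm{AHM}_3$. In any other $F$, each member
has at least three elements in $[2r]$, or has trace $\{1,y\}$ with $F$ containing everything above
$\{1,y\}$ (`IsMLCIF.three_le_card_inter_or`). Members of the first kind number $O(n^{r-3})$, while a
prescribed trace of size two on boundedly many points is taken by order $n^{r-2}$ sets.

Hence, if $F$ is neither the star nor $\mathrm{AHM}_3$ and misses some set above $\{1,y\}$ for a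
$y\in X$, it loses to the star (`IsMLCIF.hit_lt_hit_star1`). If instead $F$ contains everything
above $\{1,m\}$ with $m=\max X$ and $3\le m\le r+1$, its members avoiding 1 include $[2,m]$, so its
hits all lie in $\mathrm{AHM}_m$ (`IsMLCIF.hit_lt_hit_AHM_of_containsAbove`). For $m>r+1$ only the
star contains everything above $\{1,m\}$.

For $X\ne\{2\}$ this leaves the star, $\mathrm{AHM}_3$ and $\mathrm{AHM}_m$. When $X\subseteq[2,m]$,
$\mathrm{AHM}_m$ gains on the star the sets above $[2,m]$ without 1. Exchanging $\{1,m\}$ with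
$\{2,3\}$ shows that $\mathrm{AHM}_3$ gains the sets above $\{2,3,m\}$ without 1 when $X$ meets
$\{2,3\}$ and has just $m$ outside it (`hit_AHM_three_eq`). Whenever $X\not\subseteq\{2,3\}$ and
this condition fails, $\mathrm{AHM}_3$ loses to the star. Comparing these gains gives the cases,
with the tie at $m=4$ because $[2,4]=\{2,3,4\}$. -/

lemma mem_uniformSets {n r : ℕ} {A : Finset ℕ} :
    A ∈ uniformSets n r ↔ A ⊆ Icc 1 n ∧ #A = r := by
  simp [uniformSets, mem_powersetCard]

lemma mem_star1 {n r : ℕ} {A : Finset ℕ} :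
    A ∈ star1 n r ↔ A ∈ uniformSets n r ∧ 1 ∈ A := by
  simp [star1]

lemma mem_AHM {n r t : ℕ} {A : Finset ℕ} :
    A ∈ AHM n r t ↔
      A ∈ uniformSets n r ∧ ((1 ∈ A ∧ (A ∩ Icc 2 t).Nonempty) ∨ Icc 2 t ⊆ A) := by
  simp only [AHM, mem_union, mem_filter, mem_star1]
  tauto

lemma insert_erase_mem_uniformSets {n r i j : ℕ} {A : Finset ℕ} (hA : A ∈ uniformSets n r)
    (hj : j ∈ Icc 1 n) (hiA : i ∈ A) (hjA : j ∉ A) :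
    insert j (A.erase i) ∈ uniformSets n r := by
  rw [mem_uniformSets] at hA ⊢
  refine ⟨insert_subset hj ((erase_subset _ _).trans hA.1), ?_⟩
  rw [card_insert_of_notMem (fun h => hjA (mem_of_mem_erase h)), card_erase_of_mem hiA, hA.2]
  have : 0 < #A := card_pos.2 ⟨i, hiA⟩
  omega

/-- Being left-compressed means being closed under replacing an element by a smaller one. -/
lemma leftCompressed_iff {n : ℕ} {F : Finset (Finset ℕ)} :
    LeftCompressed n F ↔ ∀ i ∈ Icc 1 n, ∀ j ∈ Icc 1 n, j < i → ∀ A ∈ F, i ∈ A → j ∉ A →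
      insert j (A.erase i) ∈ F := by
  have key : ∀ i j : ℕ, j < i → ∀ A : Finset ℕ, i ∈ A → j ∉ A →
      UV.compress {j} {i} A = insert j (A.erase i) := by
    intro i j hij A hi hj
    rw [UV.compress, if_pos (by simp [hi, hj])]
    ext x
    simp only [sup_eq_union, mem_sdiff, mem_union, mem_singleton, mem_insert, mem_erase]
    constructor
    · tauto
    · rintro (rfl | h)
      · exact ⟨Or.inr rfl, hij.ne⟩
      · tauto
  constructor
  · intro h i hi j hj hij A hA hiA hjA
    have := UV.compress_mem_compression (u := ({j} : Finset ℕ)) (v := {i}) hA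
    rwa [h i hi j hj hij, key i j hij A hiA hjA] at this
  · intro h i hi j hj hij
    have hc : ∀ A ∈ F, UV.compress {j} {i} A ∈ F := by
      intro A hA
      by_cases hc : i ∈ A ∧ j ∉ A
      · rw [key i j hij A hc.1 hc.2]
        exact h i hi j hj hij A hA hc.1 hc.2
      · rw [UV.compress, if_neg (by simpa [and_comm] using hc)]
        exact hA
    ext A
    rw [UV.mem_compression]
    constructor
    · rintro (h | ⟨-, B, hB, rfl⟩)
      · exact h.1
      · exact hc B hB
    · exact fun hA => Or.inl ⟨hA, hc A hA⟩

lemma IsLCIF.shift_mem {n r i j : ℕ} {F : Finset (Finset ℕ)} (hF : IsLCIF n r F)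
    {A : Finset ℕ} (hA : A ∈ F) (hj : 1 ≤ j) (hij : j < i) (hiA : i ∈ A) (hjA : j ∉ A) :
    insert j (A.erase i) ∈ F := by
  have hi := mem_Icc.1 ((mem_uniformSets.1 (hF.1 hA)).1 hiA)
  exact leftCompressed_iff.1 hF.2.1 i (mem_Icc.2 hi) j (mem_Icc.2 ⟨hj, by omega⟩) hij A hA hiA hjA

/-! ### Families containing all sets above a given set. -/

lemma exists_uniformSet_disjoint {n r : ℕ} (hn : 2 * r ≤ n) {S A : Finset ℕ} (hS : S ⊆ Icc 1 n)
    (hSr : #S ≤ r) (hAr : #A ≤ r) (hd : Disjoint S A) :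
    ∃ B ∈ uniformSets n r, S ⊆ B ∧ Disjoint B A := by
  have h1 : S ⊆ Icc 1 n \ A := fun x hx =>
    mem_sdiff.2 ⟨hS hx, fun h => disjoint_left.1 hd hx h⟩
  have h2 : r ≤ #(Icc 1 n \ A) := by
    have := le_card_sdiff A (Icc 1 n)
    rw [Nat.card_Icc] at this
    omega
  obtain ⟨B, hSB, hB, hc⟩ := exists_subsuperset_card_eq h1 hSr h2
  exact ⟨B, mem_uniformSets.2 ⟨hB.trans sdiff_subset, hc⟩, hSB,
    disjoint_left.2 fun x hx => (mem_sdiff.1 (hB hx)).2⟩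

/-- `F` contains every `r`-subset of `[n]` that includes `S`. -/
def ContainsAbove (n r : ℕ) (F : Finset (Finset ℕ)) (S : Finset ℕ) : Prop :=
  ∀ A ∈ uniformSets n r, S ⊆ A → A ∈ F

/-- If $A$ lacks $b$, trade $c$ for $b$ to land above the old set, hence in $F$; the shift from $b$
to $c$ then restores $A$. -/
lemma ContainsAbove.shift {n r b c : ℕ} {F : Finset (Finset ℕ)} {S : Finset ℕ}
    (hF : IsLCIF n r F) (h : ContainsAbove n r F (insert b S)) (hb : b ≤ n) (hc : 1 ≤ c)
    (hcb : c < b) (hcS : c ∉ S) : ContainsAbove n r F (insert c S) := by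
  intro A hA hSA
  rw [insert_subset_iff] at hSA
  by_cases hbA : b ∈ A
  · exact h A hA (insert_subset hbA hSA.2)
  · have h1 : insert b (A.erase c) ∈ F := by
      refine h _ (insert_erase_mem_uniformSets hA (mem_Icc.2 ⟨by omega, hb⟩) hSA.1 hbA) ?_
      refine insert_subset_insert _ fun x hx => mem_erase.2 ⟨?_, hSA.2 hx⟩
      rintro rfl
      exact hcS hx
    have h2 := hF.shift_mem h1 hc hcb (mem_insert_self _ _) (by simp [hcb.ne])
    rwa [erase_insert (by simp [hbA]), insert_erase hSA.1] at h2

/-- If `F` contains all sets above `S`, then every member of `F` meets `S`. -/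
lemma ContainsAbove.not_disjoint {n r : ℕ} (hn : 2 * r ≤ n) {F : Finset (Finset ℕ)}
    {S A : Finset ℕ} (hF : IsLCIF n r F) (h : ContainsAbove n r F S) (hS : S ⊆ Icc 1 n)
    (hSr : #S ≤ r) (hA : A ∈ F) : ¬ Disjoint S A := by
  intro hd
  obtain ⟨B, hB, hSB, hBA⟩ :=
    exists_uniformSet_disjoint hn hS hSr (mem_uniformSets.1 (hF.1 hA)).2.le hd
  exact hF.2.2 (h B hB hSB) hA hBA

lemma ContainsAbove.mem_of_one_notMem {n r y : ℕ} (hr : 3 ≤ r) (hn : 2 * r ≤ n)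
    {F : Finset (Finset ℕ)} {A : Finset ℕ} (hF : IsLCIF n r F)
    (h : ContainsAbove n r F {y, 1}) (hy : y ∈ Icc 2 n) (hA : A ∈ F) (h1 : 1 ∉ A) : y ∈ A := by
  rw [mem_Icc] at hy
  have := h.not_disjoint hn hF
    (by intro x; simp only [mem_insert, mem_singleton, mem_Icc]; omega)
    ((card_le_two).trans (by omega)) hA
  by_contra hyA
  exact this (by simp [h1, hyA])

/-! ### Maximality of the star and of the adjusted Hilton-Milner families. -/

lemma isMLCIF_star1 {n r : ℕ} (hr : 3 ≤ r) (hn : 2 * r ≤ n) : IsMLCIF n r (star1 n r) := by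
  refine ⟨⟨filter_subset _ _, ?_, ?_⟩, ?_⟩
  · rw [leftCompressed_iff]
    intro i hi j hj hij A hA hiA hjA
    rw [mem_star1] at hA ⊢
    refine ⟨insert_erase_mem_uniformSets hA.1 hj hiA hjA, ?_⟩
    rw [mem_Icc] at hj
    exact mem_insert_of_mem (mem_erase.2 ⟨by omega, hA.2⟩)
  · intro A hA B hB hd
    exact disjoint_left.1 hd (mem_star1.1 hA).2 (mem_star1.1 hB).2
  · intro G hG hle A hA
    refine mem_star1.2 ⟨hG.1 hA, ?_⟩
    by_contra h1
    have h : ContainsAbove n r G {1} := fun B hB h1B =>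
      hle (mem_star1.2 ⟨hB, singleton_subset_iff.1 h1B⟩)
    exact h.not_disjoint hn hG (by simp; omega) (by simp; omega) hA (by simpa using h1)

lemma isMLCIF_AHM {n r t : ℕ} (hr : 3 ≤ r) (hn : 2 * r ≤ n) (ht : 3 ≤ t) (htr : t ≤ r + 1) :
    IsMLCIF n r (AHM n r t) := by
  refine ⟨⟨fun A hA => (mem_AHM.1 hA).1, ?_, ?_⟩, ?_⟩
  · rw [leftCompressed_iff]
    intro i hi j hj hij A hA hiA hjA
    rw [mem_AHM] at hA ⊢
    refine ⟨insert_erase_mem_uniformSets hA.1 hj hiA hjA, ?_⟩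
    rw [mem_Icc] at hi hj
    rcases hA.2 with ⟨h1, x, hx⟩ | h
    · refine Or.inl ⟨mem_insert_of_mem (mem_erase.2 ⟨by omega, h1⟩), ?_⟩
      rw [mem_inter, mem_Icc] at hx
      by_cases hxi : x = i
      · have : j ≠ 1 := by rintro rfl; exact hjA h1
        exact ⟨j, mem_inter.2 ⟨mem_insert_self _ _, mem_Icc.2 (by omega)⟩⟩
      · exact ⟨x, mem_inter.2 ⟨mem_insert_of_mem (mem_erase.2 ⟨hxi, hx.1⟩), mem_Icc.2 hx.2⟩⟩
    · by_cases hit : i ≤ t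
      · have hj1 : j = 1 := by
          by_contra hj1
          exact hjA (h (mem_Icc.2 (by omega)))
        subst hj1
        refine Or.inl ⟨mem_insert_self _ _, ?_⟩
        -- This is where $t\ge 3$ matters: after $i$ is moved to 1, another element of $[2,t]$ must
        -- remain.
        obtain ⟨x, hx, hxi⟩ : ∃ x ∈ Icc 2 t, x ≠ i := by
          by_cases h2 : i = 2
          · exact ⟨3, mem_Icc.2 (by omega), by omega⟩
          · exact ⟨2, mem_Icc.2 (by omega), by omega⟩
        exact ⟨x, mem_inter.2 ⟨mem_insert_of_mem (mem_erase.2 ⟨hxi, h hx⟩), hx⟩⟩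
      · refine Or.inr fun x hx => mem_insert_of_mem (mem_erase.2 ⟨?_, h hx⟩)
        rw [mem_Icc] at hx
        omega
  · intro A hA B hB hd
    rw [disjoint_left] at hd
    have h2 : 2 ∈ Icc 2 t := mem_Icc.2 (by omega)
    rcases (mem_AHM.1 hA).2 with ⟨h1, x, hx⟩ | h <;>
      rcases (mem_AHM.1 hB).2 with ⟨h1', y, hy⟩ | h'
    · exact hd h1 h1'
    · rw [mem_inter] at hx
      exact hd hx.1 (h' hx.2)
    · rw [mem_inter] at hy
      exact hd (h hy.2) hy.1
    · exact hd (h h2) (h' h2)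
  · intro G hG hle A hA
    refine mem_AHM.2 ⟨hG.1 hA, ?_⟩
    by_cases h1 : 1 ∈ A
    · refine Or.inl ⟨h1, ?_⟩
      have h : ContainsAbove n r G (Icc 2 t) := fun B hB h1B => hle (mem_AHM.2 ⟨hB, Or.inr h1B⟩)
      have := h.not_disjoint hn hG (Icc_subset_Icc (by omega) (by omega))
        (by rw [Nat.card_Icc]; omega) hA
      rwa [disjoint_comm, disjoint_iff_inter_eq_empty, ← ne_eq, ← nonempty_iff_ne_empty] at this
    · refine Or.inr fun x hx => ?_
      have hx' := mem_Icc.1 hx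
      refine ContainsAbove.mem_of_one_notMem hr hn hG (y := x) (fun B hB hxB => ?_)
        (mem_Icc.2 (by omega)) hA h1
      exact hle (mem_AHM.2 ⟨hB, Or.inl ⟨hxB (by simp),
        x, mem_inter.2 ⟨hxB (by simp), hx⟩⟩⟩)

lemma IsMLCIF.eq_of_subset {n r : ℕ} {F G : Finset (Finset ℕ)} (hG : IsMLCIF n r G)
    (hF : IsMLCIF n r F) (h : G ⊆ F) : F = G :=
  (hG.2 hF.1 h).antisymm h

/-! ### Traces on $[2r]$. -/

/-- If all common elements exceed $2r$, then $A\cup B$, of size at most $2r$, misses some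
$j\in[2r]$. Moving a common element of $A$ to $j$ shrinks the intersection, so induction on its size
applies. -/
lemma IsLCIF.inter_nonempty {n r : ℕ} (hr : 3 ≤ r) {F : Finset (Finset ℕ)} (hF : IsLCIF n r F)
    {A B : Finset ℕ} (hA : A ∈ F) (hB : B ∈ F) : (A ∩ B ∩ Icc 1 (2 * r)).Nonempty := by
  induction hk : #(A ∩ B) using Nat.strong_induction_on generalizing A with
  | _ k ih =>
  by_contra hne
  rw [not_nonempty_iff_eq_empty] at hne
  obtain ⟨c, hcA, hcB⟩ := not_disjoint_iff.1 (hF.2.2 hA hB)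
  have hcn := mem_Icc.1 ((mem_uniformSets.1 (hF.1 hA)).1 hcA)
  have hc2 : 2 * r < c := by
    by_contra h
    have : c ∈ A ∩ B ∩ Icc 1 (2 * r) := by
      simp only [mem_inter, mem_Icc]; exact ⟨⟨hcA, hcB⟩, by omega⟩
    simp [hne] at this
  obtain ⟨j, hj, hjAB⟩ : ∃ j ∈ Icc 1 (2 * r), j ∉ A ∪ B := by
    by_contra! h
    have h1 : insert c (Icc 1 (2 * r)) ⊆ A ∪ B :=
      insert_subset (mem_union_left _ hcA) h
    have h2 := card_le_card h1
    rw [card_insert_of_notMem (by simp; omega), Nat.card_Icc] at h2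
    have h3 := card_union_le A B
    rw [(mem_uniformSets.1 (hF.1 hA)).2, (mem_uniformSets.1 (hF.1 hB)).2] at h3
    omega
  rw [mem_union, not_or] at hjAB
  rw [mem_Icc] at hj
  have hsub : insert j (A.erase c) ∩ B = (A ∩ B).erase c := by
    rw [insert_inter_of_notMem hjAB.2, erase_inter]
  have hcAB : c ∈ A ∩ B := mem_inter.2 ⟨hcA, hcB⟩
  have h := ih _ (by rw [hsub, ← hk]; exact card_erase_lt_of_mem hcAB)
    (hF.shift_mem hA hj.1 (by omega) hcA hjAB.1) rfl
  rw [hsub] at h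
  have := h.mono (inter_subset_inter_right (erase_subset c (A ∩ B)))
  rw [hne] at this
  simp at this

/-- A maximal left-compressed intersecting family is determined by traces on `[2r]`. -/
lemma IsMLCIF.containsAbove_inter {n r : ℕ} (hr : 3 ≤ r)
    {F : Finset (Finset ℕ)} (hF : IsMLCIF n r F) {B : Finset ℕ} (hB : B ∈ F) :
    ContainsAbove n r F (B ∩ Icc 1 (2 * r)) := by
  classical
  -- The family generated by the traces is again left-compressed and intersecting, so maximality of
  -- $F$ absorbs it.
  set G : Finset (Finset ℕ) := {A ∈ uniformSets n r | ∃ B ∈ F, B ∩ Icc 1 (2 * r) ⊆ A} with hG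
  have hLC : IsLCIF n r G := by
    refine ⟨filter_subset _ _, ?_, ?_⟩
    · rw [leftCompressed_iff]
      intro i hi j hj hij A hA hiA hjA
      rw [hG, mem_filter] at hA ⊢
      obtain ⟨hA, B, hB, hBA⟩ := hA
      refine ⟨insert_erase_mem_uniformSets hA hj hiA hjA, ?_⟩
      rw [mem_Icc] at hi hj
      -- If $i$ belongs to the generating trace, $B$ is shifted along with $A$; otherwise the same
      -- trace still works.
      by_cases hiB : i ∈ B ∩ Icc 1 (2 * r)
      · have hi2 := mem_Icc.1 (mem_inter.1 hiB).2
        have hjB : j ∉ B := fun h => hjA (hBA (mem_inter.2 ⟨h, mem_Icc.2 (by omega)⟩))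
        refine ⟨_, hF.1.shift_mem hB hj.1 hij (mem_inter.1 hiB).1 hjB, fun x hx => ?_⟩
        simp only [mem_inter, mem_insert, mem_erase] at hx ⊢
        rcases hx.1 with h | h
        · exact Or.inl h
        · exact Or.inr ⟨h.1, hBA (mem_inter.2 ⟨h.2, hx.2⟩)⟩
      · refine ⟨B, hB, fun x hx => mem_insert_of_mem (mem_erase.2 ⟨?_, hBA hx⟩)⟩
        rintro rfl
        exact hiB hx
    · intro A hA A' hA' hd
      rw [mem_coe, hG, mem_filter] at hA hA'
      obtain ⟨_, B, hB, hBA⟩ := hA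
      obtain ⟨_, B', hB', hBA'⟩ := hA'
      obtain ⟨x, hx⟩ := hF.1.inter_nonempty hr hB hB'
      simp only [mem_inter] at hx
      exact disjoint_left.1 hd (hBA (mem_inter.2 ⟨hx.1.1, hx.2⟩))
        (hBA' (mem_inter.2 ⟨hx.1.2, hx.2⟩))
  have hFG : F ⊆ G := fun A hA =>
    mem_filter.2 ⟨hF.1.1 hA, A, hA, inter_subset_left⟩
  exact fun A hA h => hF.2 hLC hFG (mem_filter.2 ⟨hA, B, hB, h⟩)

lemma IsMLCIF.eq_star1 {n r : ℕ} (hr : 3 ≤ r) (hn : 2 * r ≤ n) {F : Finset (Finset ℕ)}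
    (hF : IsMLCIF n r F) (h : ContainsAbove n r F {1}) : F = star1 n r :=
  (isMLCIF_star1 hr hn).eq_of_subset hF fun A hA =>
    h A (mem_star1.1 hA).1 (singleton_subset_iff.2 (mem_star1.1 hA).2)

lemma IsMLCIF.eq_AHM {n r t : ℕ} (hr : 3 ≤ r) (hn : 2 * r ≤ n) (ht : 3 ≤ t) (htr : t ≤ r + 1)
    {F : Finset (Finset ℕ)} (hF : IsMLCIF n r F)
    (h : ∀ x ∈ Icc 2 t, ContainsAbove n r F {x, 1}) (h' : ContainsAbove n r F (Icc 2 t)) :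
    F = AHM n r t := by
  refine (isMLCIF_AHM hr hn ht htr).eq_of_subset hF fun A hA => ?_
  obtain ⟨hA, ⟨h1, x, hx⟩ | hA'⟩ := mem_AHM.1 hA
  · rw [mem_inter] at hx
    exact h x hx.2 A hA (insert_subset hx.1 (singleton_subset_iff.2 h1))
  · exact h' A hA hA'

lemma ContainsAbove.mono_pair {n r x y : ℕ} {F : Finset (Finset ℕ)} (hF : IsLCIF n r F)
    (h : ContainsAbove n r F {y, 1}) (hx : 2 ≤ x) (hxy : x ≤ y) (hy : y ≤ n) :
    ContainsAbove n r F {x, 1} := by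
  rcases hxy.eq_or_lt with rfl | hlt
  · exact h
  · exact h.shift hF hy (by omega) hlt (by simp; omega)

/-- The small traces of a maximal family other than the star and `AHM n r 3`. -/
lemma IsMLCIF.three_le_card_inter_or {n r : ℕ} (hr : 3 ≤ r) (hn : 2 * r ≤ n)
    {F : Finset (Finset ℕ)} (hF : IsMLCIF n r F) (h1 : F ≠ star1 n r) (h3 : F ≠ AHM n r 3)
    {B : Finset ℕ} (hB : B ∈ F) :
    3 ≤ #(B ∩ Icc 1 (2 * r)) ∨
      ∃ y ∈ Icc 2 (2 * r), B ∩ Icc 1 (2 * r) = {y, 1} ∧ ContainsAbove n r F {y, 1} := by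
  by_contra! hcon
  obtain ⟨hlt, hcon⟩ := hcon
  have hC := hF.containsAbove_inter hr hB
  have hpos : 0 < #(B ∩ Icc 1 (2 * r)) := by
    have := hF.1.inter_nonempty hr hB hB
    rw [inter_self] at this
    exact card_pos.2 this
  have hmem : ∀ x ∈ B ∩ Icc 1 (2 * r), 1 ≤ x ∧ x ≤ 2 * r := fun x hx =>
    mem_Icc.1 (mem_inter.1 hx).2
  obtain hc | hc : #(B ∩ Icc 1 (2 * r)) = 1 ∨ #(B ∩ Icc 1 (2 * r)) = 2 := by omega
  · obtain ⟨a, ha⟩ := card_eq_one.1 hc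
    rw [ha] at hC hmem
    have := hmem a (mem_singleton_self a)
    refine h1 (hF.eq_star1 hr hn ?_)
    by_cases ha1 : a = 1
    · rwa [ha1] at hC
    · exact ContainsAbove.shift (S := ∅) hF.1 hC (by omega) le_rfl (by omega) (by simp)
  · obtain ⟨a, b, hab, hg⟩ : ∃ a b, a < b ∧ B ∩ Icc 1 (2 * r) = {b, a} := by
      obtain ⟨a, b, hab, hg⟩ := card_eq_two.1 hc
      rcases hab.lt_or_gt with h | h
      · exact ⟨a, b, h, by rw [hg, pair_comm]⟩
      · exact ⟨b, a, h, hg⟩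
    have ha := hmem a (by simp [hg])
    have hb := hmem b (by simp [hg])
    rw [hg] at hC
    by_cases ha1 : a = 1
    · subst ha1
      exact hcon b (mem_Icc.2 (by omega)) hg hC
    · have h2b : ContainsAbove n r F {b, 2} := by
        rw [pair_comm] at hC ⊢
        by_cases ha2 : a = 2
        · rwa [ha2] at hC
        · exact hC.shift hF.1 (by omega) (by omega) (by omega) (by simp; omega)
      have h23 : ContainsAbove n r F {3, 2} := by
        by_cases hb3 : b = 3
        · rwa [hb3] at h2b
        · exact h2b.shift hF.1 (by omega) (by omega) (by omega) (by simp)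
      have h13 : ContainsAbove n r F {3, 1} := by
        rw [pair_comm] at h23 ⊢
        exact h23.shift hF.1 (by omega) (by omega) (by omega) (by simp)
      refine h3 (hF.eq_AHM hr hn le_rfl (by omega) (fun x hx => ?_) ?_)
      · rw [mem_Icc] at hx
        exact h13.mono_pair hF.1 hx.1 hx.2 (by omega)
      · have : Icc 2 3 = ({3, 2} : Finset ℕ) := by decide
        rwa [this]

/-- Some member avoids 1, since $F$ is not the star. It meets $\{1,x\}$ for every $x\in[2,y]$, so
its $r$ elements include $[2,y]$. -/
lemma IsMLCIF.le_of_containsAbove {n r y : ℕ} (hr : 3 ≤ r) (hn : 2 * r ≤ n)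
    {F : Finset (Finset ℕ)} (hF : IsMLCIF n r F) (h1 : F ≠ star1 n r)
    (h : ContainsAbove n r F {y, 1}) (hy : y ≤ n) : y ≤ r + 1 := by
  obtain ⟨A, hA, h1A⟩ : ∃ A ∈ F, 1 ∉ A := by
    by_contra! hall
    exact h1 (hF.eq_of_subset (isMLCIF_star1 hr hn) fun A hA =>
      mem_star1.2 ⟨hF.1.1 hA, hall A hA⟩).symm
  have hsub : Icc 2 y ⊆ A := fun x hx => by
    have hx' := mem_Icc.1 hx
    exact (h.mono_pair hF.1 hx'.1 hx'.2 hy).mem_of_one_notMem hr hn hF.1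
      (mem_Icc.2 (by omega)) hA h1A
  have := card_le_card hsub
  rw [Nat.card_Icc, (mem_uniformSets.1 (hF.1.1 hA)).2] at this
  omega

/-! ### Counting sets by their traces. -/

lemma inter_singleton_nonempty_iff {A : Finset ℕ} {a : ℕ} : (A ∩ {a}).Nonempty ↔ a ∈ A := by
  rw [← not_disjoint_iff_nonempty_inter, disjoint_singleton_right, not_not]

lemma card_filter_inter_eq {n r : ℕ} {S T : Finset ℕ} (hS : S ⊆ Icc 1 n) (hT : T ⊆ S)
    (hTr : #T ≤ r) :
    #{A ∈ uniformSets n r | A ∩ S = T} = (n - #S).choose (r - #T) := by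
  have hcard : #(powersetCard (r - #T) (Icc 1 n \ S)) = (n - #S).choose (r - #T) := by
    rw [card_powersetCard, card_sdiff_of_subset hS, Nat.card_Icc, Nat.add_sub_cancel]
  rw [← hcard]
  refine card_bij' (fun A _ => A \ S) (fun B _ => B ∪ T) ?_ ?_ ?_ ?_
  · intro A hA
    rw [mem_filter, mem_uniformSets] at hA
    refine mem_powersetCard.2 ⟨sdiff_subset_sdiff hA.1.1 subset_rfl, ?_⟩
    rw [card_sdiff, inter_comm, hA.2, hA.1.2]
  · intro B hB
    rw [mem_powersetCard] at hB
    have hBS : Disjoint B S := disjoint_left.2 fun x hx => (mem_sdiff.1 (hB.1 hx)).2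
    rw [mem_filter, mem_uniformSets]
    refine ⟨⟨union_subset (hB.1.trans sdiff_subset) (hT.trans hS), ?_⟩, ?_⟩
    · rw [card_union_of_disjoint (hBS.mono_right hT), hB.2]
      omega
    · rw [union_inter_distrib_right, disjoint_iff_inter_eq_empty.1 hBS, empty_union,
        inter_eq_left.2 hT]
  · intro A hA
    rw [mem_filter] at hA
    rw [← hA.2, inter_comm A S, inter_comm S A, sdiff_union_inter]
  · intro B hB
    rw [mem_powersetCard] at hB
    have hBS : Disjoint B S := disjoint_left.2 fun x hx => (mem_sdiff.1 (hB.1 hx)).2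
    rw [union_sdiff_distrib, sdiff_eq_empty_iff_subset.2 hT, union_empty,
      sdiff_eq_self_of_disjoint hBS]

lemma card_filter_superset {n r : ℕ} {T : Finset ℕ} (hT : T ⊆ Icc 1 n) (hTr : #T ≤ r) :
    #{A ∈ uniformSets n r | T ⊆ A} = (n - #T).choose (r - #T) := by
  rw [← card_filter_inter_eq hT subset_rfl hTr]
  simp only [inter_eq_right]

lemma card_filter_three_le_inter_le {n r : ℕ} (hr : 3 ≤ r) (hn : 2 * r ≤ n) :
    #{A ∈ uniformSets n r | 3 ≤ #(A ∩ Icc 1 (2 * r))} ≤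
      (2 * r).choose 3 * (n - 3).choose (r - 3) := by
  have h1 : {A ∈ uniformSets n r | 3 ≤ #(A ∩ Icc 1 (2 * r))} ⊆
      (powersetCard 3 (Icc 1 (2 * r))).biUnion fun T => {A ∈ uniformSets n r | T ⊆ A} := by
    intro A hA
    rw [mem_filter] at hA
    obtain ⟨T, hT, hc⟩ := exists_subset_card_eq hA.2
    exact mem_biUnion.2 ⟨T, mem_powersetCard.2 ⟨hT.trans inter_subset_right, hc⟩,
      mem_filter.2 ⟨hA.1, hT.trans inter_subset_left⟩⟩
  refine (card_le_card h1).trans ((card_biUnion_le_card_mul _ _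
    ((n - 3).choose (r - 3)) ?_).trans ?_)
  · intro T hT
    rw [mem_powersetCard] at hT
    rw [card_filter_superset (hT.1.trans (Icc_subset_Icc_right hn)) (by omega), hT.2]
  · rw [card_powersetCard, Nat.card_Icc, Nat.add_sub_cancel]

/-- `n` is large in terms of `r`. -/
def IsLarge (n r : ℕ) : Prop :=
  2 * r + 2 ≤ n ∧ (2 * r).choose 3 * (n - 3).choose (r - 3) < (n - (2 * r + 2)).choose (r - 2)

lemma exists_forall_isLarge {r : ℕ} (hr : 3 ≤ r) : ∃ N, ∀ n, N ≤ n → IsLarge n r := by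
  obtain ⟨k, rfl⟩ := Nat.exists_eq_add_of_le' hr
  set c := (2 * (k + 3)).choose 3 with hc
  -- With $r=k+3$ the two sides have orders $n^k$ and $n^{k+1}$. The first summand makes the base
  -- $n-3k-8$ of the falling-factorial bound at least $n/2$; the second makes $n$ exceed the
  -- accumulated constants.
  refine ⟨2 * (3 * k + 9) + c * (k + 1).factorial * 2 ^ (k + 1) + 1, fun n hn => ⟨by omega, ?_⟩⟩
  rw [show k + 3 - 3 = k by omega, show k + 3 - 2 = k + 1 by omega]
  have h1 : (n - 3).choose k ≤ n ^ k :=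
    (Nat.choose_le_pow _ _).trans (Nat.pow_le_pow_left (by omega) _)
  have h2 : (n - (2 * (k + 3) + 2) + 1 - (k + 1)) ^ (k + 1) ≤
      (k + 1).factorial * (n - (2 * (k + 3) + 2)).choose (k + 1) := by
    rw [← Nat.descFactorial_eq_factorial_mul_choose]
    exact Nat.pow_sub_le_descFactorial _ _
  have h3 : n ^ (k + 1) ≤ 2 ^ (k + 1) * (n - (2 * (k + 3) + 2) + 1 - (k + 1)) ^ (k + 1) := by
    rw [← mul_pow]
    exact Nat.pow_le_pow_left (by omega) _
  have hn0 : 0 < n ^ k := pow_pos (by omega) _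
  have h4 : c * (k + 1).factorial * 2 ^ (k + 1) * n ^ k < n ^ (k + 1) := by
    rw [pow_succ n, mul_comm (n ^ k)]
    exact Nat.mul_lt_mul_of_pos_right (by omega) hn0
  have h5 : (2 ^ (k + 1) * (k + 1).factorial) * (c * (n - 3).choose k) <
      (2 ^ (k + 1) * (k + 1).factorial) * (n - (2 * (k + 3) + 2)).choose (k + 1) :=
    calc (2 ^ (k + 1) * (k + 1).factorial) * (c * (n - 3).choose k)
        = c * (k + 1).factorial * 2 ^ (k + 1) * (n - 3).choose k := by ring
      _ ≤ c * (k + 1).factorial * 2 ^ (k + 1) * n ^ k := Nat.mul_le_mul_left _ h1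
      _ < n ^ (k + 1) := h4
      _ ≤ _ := h3
      _ ≤ _ := Nat.mul_le_mul_left _ h2
      _ = _ := by ring
  exact lt_of_mul_lt_mul_left h5 (Nat.zero_le _)

/-- For large `n`, the sets with a given trace of size two outnumber those meeting `[2r]` in at
least three elements. -/
lemma IsLarge.lt_card_filter_inter_eq {n r : ℕ} (hr : 3 ≤ r) (h : IsLarge n r) {S T : Finset ℕ}
    (hS : S ⊆ Icc 1 n) (hSr : #S ≤ 2 * r + 2) (hT : T ⊆ S) (hT2 : #T = 2) :
    (2 * r).choose 3 * (n - 3).choose (r - 3) < #{A ∈ uniformSets n r | A ∩ S = T} := by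
  rw [card_filter_inter_eq hS hT (by omega), hT2]
  exact h.2.trans_le (Nat.choose_le_choose _ (by omega))

lemma IsLarge.card_superset_lt_card_filter_inter_eq {n r : ℕ} (hr : 3 ≤ r) (h : IsLarge n r)
    {R S T : Finset ℕ} (hR : R ⊆ Icc 1 n) (hR3 : #R = 3) (hS : S ⊆ Icc 1 n) (hSr : #S ≤ 2 * r + 2)
    (hT : T ⊆ S) (hT2 : #T = 2) :
    #{A ∈ uniformSets n r | R ⊆ A} < #{A ∈ uniformSets n r | A ∩ S = T} := by
  refine lt_of_le_of_lt ?_ (h.lt_card_filter_inter_eq hr hS hSr hT hT2)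
  rw [card_filter_superset hR (by omega), hR3]
  exact Nat.le_mul_of_pos_left _ (Nat.choose_pos (by omega))

/-! ### An arbitrary maximal family against the star and $\mathrm{AHM}_m$. -/

lemma mem_Icc_two_of_mem {n y : ℕ} {X : Finset ℕ} (hX : X ⊆ Icc 2 n) (hy : y ∈ X) :
    2 ≤ y ∧ y ≤ n :=
  mem_Icc.1 (hX hy)

/-- A maximal family missing some set above `{1, y}`, where `y ∈ X`, is worse than the star. -/
lemma IsMLCIF.hit_lt_hit_star1 {n r y : ℕ} (hr : 3 ≤ r) (hn : IsLarge n r)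
    {F : Finset (Finset ℕ)} (hF : IsMLCIF n r F) (h1 : F ≠ star1 n r) (h3 : F ≠ AHM n r 3)
    {X : Finset ℕ} (hX : X ⊆ Icc 2 n) (hy : y ∈ X) (hFy : ¬ ContainsAbove n r F {y, 1}) :
    hit X F < hit X (star1 n r) := by
  have hn' := hn.1
  have hy' := mem_Icc_two_of_mem hX hy
  set E : Finset (Finset ℕ) := {A ∈ uniformSets n r | 3 ≤ #(A ∩ Icc 1 (2 * r))} with hE
  -- Star hits that $F$ can share only through `E`. The point $y$ is adjoined because it may exceed
  -- $2r$.
  set D : Finset (Finset ℕ) := {A ∈ uniformSets n r | A ∩ insert y (Icc 1 (2 * r)) = {y, 1}}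
    with hD
  have hED : #E < #D := by
    refine (card_filter_three_le_inter_le hr (by omega)).trans_lt
      (hn.lt_card_filter_inter_eq hr ?_ ?_ ?_ ?_)
    · exact insert_subset (mem_Icc.2 (by omega)) (Icc_subset_Icc_right (by omega))
    · refine (card_insert_le _ _).trans ?_
      rw [Nat.card_Icc]
      omega
    · exact insert_subset_insert _ (singleton_subset_iff.2 (mem_Icc.2 (by omega)))
    · exact card_pair (by omega)
  have hDmem : ∀ A ∈ D, y ∈ A ∧ 1 ∈ A := fun A hA => by
    have h : ({y, 1} : Finset ℕ) ⊆ A := (mem_filter.1 hA).2 ▸ inter_subset_left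
    exact ⟨h (by simp), h (by simp)⟩
  have hDs : D ⊆ {A ∈ star1 n r | (A ∩ X).Nonempty} := fun A hA =>
    mem_filter.2 ⟨mem_star1.2 ⟨(mem_filter.1 hA).1, (hDmem A hA).2⟩,
      y, mem_inter.2 ⟨(hDmem A hA).1, hy⟩⟩
  have hsub : {A ∈ F | (A ∩ X).Nonempty} ⊆
      E ∪ ({A ∈ star1 n r | (A ∩ X).Nonempty} \ D) := by
    intro A hA
    rw [mem_filter] at hA
    have hAu := hF.1.1 hA.1
    rcases hF.three_le_card_inter_or hr (by omega) h1 h3 hA.1 with h | ⟨z, hz, hAz, hFz⟩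
    · exact mem_union_left _ (mem_filter.2 ⟨hAu, h⟩)
    · have h1A : 1 ∈ A ∩ Icc 1 (2 * r) := by simp [hAz]
      refine mem_union_right _ (mem_sdiff.2
        ⟨mem_filter.2 ⟨mem_star1.2 ⟨hAu, (mem_inter.1 h1A).1⟩, hA.2⟩, fun hAD => ?_⟩)
      have hzA : z ∈ A ∩ Icc 1 (2 * r) := by simp [hAz]
      have hz1 : z ∈ ({y, 1} : Finset ℕ) := by
        rw [← (mem_filter.1 hAD).2]
        exact inter_subset_inter_left (subset_insert _ _) hzA
      rw [mem_Icc] at hz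
      rw [mem_insert, mem_singleton] at hz1
      obtain rfl : z = y := by omega
      exact hFy hFz
  have h5 := (card_le_card hsub).trans (card_union_le _ _)
  rw [card_sdiff_of_subset hDs] at h5
  have h6 := card_le_card hDs
  simp only [hit]
  omega

lemma IsMLCIF.hit_lt_hit_star1_of_not_subset {n r : ℕ} (hr : 3 ≤ r) (hn : IsLarge n r)
    {F : Finset (Finset ℕ)} (hF : IsMLCIF n r F) (h1 : F ≠ star1 n r) (h3 : F ≠ AHM n r 3)
    {X : Finset ℕ} (hX : X ⊆ Icc 2 n) (hXr : ¬ X ⊆ Icc 2 (r + 1)) :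
    hit X F < hit X (star1 n r) := by
  obtain ⟨y, hy, hyr⟩ := not_subset.1 hXr
  have hy' := mem_Icc_two_of_mem hX hy
  refine hF.hit_lt_hit_star1 hr hn h1 h3 hX hy fun h => hyr (mem_Icc.2 ⟨hy'.1, ?_⟩)
  exact hF.le_of_containsAbove hr (by linarith [hn.1]) h1 h hy'.2

lemma IsMLCIF.hit_lt_hit_AHM_of_containsAbove {n r m : ℕ} (hr : 3 ≤ r) (hn : 2 * r ≤ n)
    {F : Finset (Finset ℕ)} (hF : IsMLCIF n r F) {X : Finset ℕ} (hX : X ⊆ Icc 2 m) (hm : m ∈ X)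
    (hm3 : 3 ≤ m) (hmr : m ≤ r + 1) (hFm : ContainsAbove n r F {m, 1}) (hne : F ≠ AHM n r m) :
    hit X F < hit X (AHM n r m) := by
  have hpair : ∀ x ∈ Icc 2 m, ContainsAbove n r F {x, 1} := fun x hx =>
    hFm.mono_pair hF.1 (mem_Icc.1 hx).1 (mem_Icc.1 hx).2 (by omega)
  have hsub : {A ∈ F | (A ∩ X).Nonempty} ⊆ {A ∈ AHM n r m | (A ∩ X).Nonempty} := by
    intro A hA
    rw [mem_filter] at hA ⊢
    refine ⟨mem_AHM.2 ⟨hF.1.1 hA.1, ?_⟩, hA.2⟩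
    by_cases h1 : 1 ∈ A
    · exact Or.inl ⟨h1, hA.2.mono (inter_subset_inter_left hX)⟩
    · refine Or.inr fun x hx => (hpair x hx).mem_of_one_notMem hr hn hF.1 ?_ hA.1 h1
      have := mem_Icc.1 hx
      exact mem_Icc.2 (by omega)
  -- Equal hits would put every set above $[2,m]$ into $F$, since each such set contains $m\in X$;
  -- then $F=\mathrm{AHM}_m$.
  refine card_lt_card (Finset.ssubset_iff_subset_ne.2 ⟨hsub, fun heq => hne ?_⟩)
  refine hF.eq_AHM hr hn hm3 hmr hpair fun A hA hmA => ?_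
  have : A ∈ {A ∈ AHM n r m | (A ∩ X).Nonempty} :=
    mem_filter.2 ⟨mem_AHM.2 ⟨hA, Or.inr hmA⟩, m, mem_inter.2 ⟨hmA (hX hm), hm⟩⟩
  rw [← heq] at this
  exact (mem_filter.1 this).1

lemma star1_ne_AHM {n r t : ℕ} (hr : 3 ≤ r) (hn : 2 * r ≤ n) (ht : t ≤ r + 1) :
    star1 n r ≠ AHM n r t := by
  obtain ⟨B, hB, htB, hd⟩ := exists_uniformSet_disjoint (S := Icc 2 t) (A := {1}) hn
    (Icc_subset_Icc (by omega) (by omega)) (by rw [Nat.card_Icc]; omega) (by simp; omega) (by simp)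
  intro h
  have : B ∈ star1 n r := h ▸ mem_AHM.2 ⟨hB, Or.inr htB⟩
  exact disjoint_left.1 hd (mem_star1.1 this).2 (mem_singleton_self 1)

/-- The star contains everything above $\{1,m\}$, so the preceding comparison applies to it. -/
lemma hit_star1_lt_hit_AHM {n r m : ℕ} (hr : 3 ≤ r) (hn : 2 * r ≤ n) {X : Finset ℕ}
    (hX : X ⊆ Icc 2 m) (hm : m ∈ X) (hm3 : 3 ≤ m) (hmr : m ≤ r + 1) :
    hit X (star1 n r) < hit X (AHM n r m) :=
  (isMLCIF_star1 hr hn).hit_lt_hit_AHM_of_containsAbove hr hn hX hm hm3 hmr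
    (fun _ hA h => mem_star1.2 ⟨hA, h (by simp)⟩) (star1_ne_AHM hr hn hmr)

lemma IsMLCIF.hit_lt_hit_AHM {n r m : ℕ} (hr : 3 ≤ r) (hn : IsLarge n r)
    {F : Finset (Finset ℕ)} (hF : IsMLCIF n r F) {X : Finset ℕ} (hX : X ⊆ Icc 2 m) (hm : m ∈ X)
    (hm3 : 3 ≤ m) (hmr : m ≤ r + 1) (h3 : F ≠ AHM n r 3) (hne : F ≠ AHM n r m) :
    hit X F < hit X (AHM n r m) := by
  have hn' := hn.1
  by_cases hFm : ContainsAbove n r F {m, 1}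
  · exact hF.hit_lt_hit_AHM_of_containsAbove hr (by omega) hX hm hm3 hmr hFm hne
  · have hlt := hit_star1_lt_hit_AHM (n := n) hr (by omega) hX hm hm3 hmr
    by_cases h1 : F = star1 n r
    · rwa [h1]
    · exact (hF.hit_lt_hit_star1 hr hn h1 h3 (hX.trans (Icc_subset_Icc_right (by omega))) hm
        hFm).trans hlt

lemma Icc_two_three : Icc 2 3 = ({2, 3} : Finset ℕ) := by decide

/-- Hits containing 1 lie above $\{1,2\}$, and $\mathrm{AHM}_3$ has all of those. Hits of $F$
avoiding 1 have at least three elements in $[2r]$, so they are outnumbered by the sets of trace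
$\{2,3\}$. -/
lemma IsMLCIF.hit_singleton_two_lt {n r : ℕ} (hr : 3 ≤ r) (hn : IsLarge n r)
    {F : Finset (Finset ℕ)} (hF : IsMLCIF n r F) (h3 : F ≠ AHM n r 3) :
    hit {2} F < hit {2} (AHM n r 3) := by
  have hn' := hn.1
  set E : Finset (Finset ℕ) := {A ∈ uniformSets n r | 3 ≤ #(A ∩ Icc 1 (2 * r))} with hE
  set D : Finset (Finset ℕ) := {A ∈ uniformSets n r | A ∩ Icc 1 (2 * r) = {2, 3}} with hD
  set H : Finset (Finset ℕ) := {A ∈ uniformSets n r | 1 ∈ A ∧ 2 ∈ A} with hH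
  have hED : #E < #D := by
    refine (card_filter_three_le_inter_le hr (by omega)).trans_lt
      (hn.lt_card_filter_inter_eq hr (Icc_subset_Icc_right (by omega)) ?_ ?_ (card_pair (by omega)))
    · rw [Nat.card_Icc]
      omega
    · intro x
      simp only [mem_insert, mem_singleton, mem_Icc]
      omega
  have hDmem : ∀ A ∈ D, 2 ∈ A ∧ 3 ∈ A ∧ 1 ∉ A := fun A hA => by
    have h' := (mem_filter.1 hA).2
    have h : ({2, 3} : Finset ℕ) ⊆ A := h' ▸ inter_subset_left
    refine ⟨h (by simp), h (by simp), fun h1 => ?_⟩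
    have : 1 ∈ A ∩ Icc 1 (2 * r) := mem_inter.2 ⟨h1, mem_Icc.2 (by omega)⟩
    rw [h'] at this
    simp at this
  have hHD : H ∪ D ⊆ {A ∈ AHM n r 3 | (A ∩ {2}).Nonempty} := by
    intro A hA
    rw [mem_filter, mem_AHM, Icc_two_three]
    rcases mem_union.1 hA with hA | hA
    · obtain ⟨hA, h1, h2⟩ := mem_filter.1 hA
      exact ⟨⟨hA, Or.inl ⟨h1, 2, by simp [h2]⟩⟩, 2, by simp [h2]⟩
    · obtain ⟨h2, h3, -⟩ := hDmem A hA
      exact ⟨⟨(mem_filter.1 hA).1, Or.inr (by simp [insert_subset_iff, h2, h3])⟩, 2, by simp [h2]⟩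
  have hdisj : Disjoint H D := disjoint_left.2 fun A hA hA' =>
    (hDmem A hA').2.2 (mem_filter.1 hA).2.1
  have hFE : {A ∈ F | (A ∩ {2}).Nonempty} ⊆ H ∪ E := by
    intro A hA
    rw [mem_filter, inter_singleton_nonempty_iff] at hA
    have hAu := hF.1.1 hA.1
    by_cases h1A : 1 ∈ A
    · exact mem_union_left _ (mem_filter.2 ⟨hAu, h1A, hA.2⟩)
    · have hs : F ≠ star1 n r := by
        rintro rfl
        exact h1A (mem_star1.1 hA.1).2
      rcases hF.three_le_card_inter_or hr (by omega) hs h3 hA.1 with h | ⟨z, -, hz, -⟩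
      · exact mem_union_right _ (mem_filter.2 ⟨hAu, h⟩)
      · have : 1 ∈ A ∩ Icc 1 (2 * r) := by simp [hz]
        exact absurd (mem_inter.1 this).1 h1A
  have h5 := (card_le_card hFE).trans (card_union_le _ _)
  have h6 := card_le_card hHD
  rw [card_union_of_disjoint hdisj] at h6
  simp only [hit]
  omega

/-! ### The adjusted Hilton-Milner families against the star and each other. -/

lemma hit_AHM_eq {n r t : ℕ} (ht : 2 ≤ t) (X : Finset ℕ) :
    hit X (AHM n r t) =
      #{A ∈ uniformSets n r | (1 ∈ A ∧ (A ∩ X).Nonempty) ∧ (A ∩ Icc 2 t).Nonempty} +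
      #{A ∈ uniformSets n r | 1 ∉ A ∧ Icc 2 t ⊆ A ∧ (A ∩ X).Nonempty} := by
  rw [hit, ← card_union_of_disjoint]
  · congr 1
    ext A
    simp only [mem_filter, mem_union, mem_AHM]
    have : Icc 2 t ⊆ A → (A ∩ Icc 2 t).Nonempty := fun h =>
      ⟨2, mem_inter.2 ⟨h (mem_Icc.2 ⟨le_rfl, ht⟩), mem_Icc.2 ⟨le_rfl, ht⟩⟩⟩
    tauto
  · exact disjoint_filter.2 fun A _ h h' => h'.1 h.1.1

lemma hit_star1_eq {n r : ℕ} (X : Finset ℕ) :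
    hit X (star1 n r) = #{A ∈ uniformSets n r | 1 ∈ A ∧ (A ∩ X).Nonempty} := by
  rw [hit, star1, filter_filter]

/-- Balance of gains and losses in passing from the star to $\mathrm{AHM}_t$, written additively to
avoid truncated subtraction. -/
lemma hit_star1_add {n r t : ℕ} (ht : 2 ≤ t) (X : Finset ℕ) :
    hit X (star1 n r) +
      #{A ∈ uniformSets n r | 1 ∉ A ∧ Icc 2 t ⊆ A ∧ (A ∩ X).Nonempty} =
    hit X (AHM n r t) +
      #{A ∈ uniformSets n r | (1 ∈ A ∧ (A ∩ X).Nonempty) ∧ ¬ (A ∩ Icc 2 t).Nonempty} := by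
  have h := card_filter_add_card_filter_not
    (s := {A ∈ uniformSets n r | 1 ∈ A ∧ (A ∩ X).Nonempty}) (fun A => (A ∩ Icc 2 t).Nonempty)
  rw [filter_filter, filter_filter] at h
  rw [hit_AHM_eq ht, hit_star1_eq]
  omega

/-- If `X ⊆ [2, t]`, then `AHM n r t` gains on the star exactly the sets above `[2, t]`. -/
lemma hit_AHM_eq_hit_star1_add {n r t : ℕ} (ht : 2 ≤ t) {X : Finset ℕ} (hX : X ⊆ Icc 2 t)
    (hne : X.Nonempty) :
    hit X (AHM n r t) = hit X (star1 n r) + #{A ∈ uniformSets n r | 1 ∉ A ∧ Icc 2 t ⊆ A} := by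
  rw [hit_AHM_eq ht, hit_star1_eq]
  congr 2
  · refine filter_congr fun A _ => and_iff_left_iff_imp.2 fun h => ?_
    exact h.2.mono (inter_subset_inter_left hX)
  · refine filter_congr fun A _ => ?_
    have : Icc 2 t ⊆ A → (A ∩ X).Nonempty := fun h =>
      hne.mono fun x hx => mem_inter.2 ⟨h (hX hx), hx⟩
    tauto

/-- The sets containing `2, 3` but not `1`, compared with those containing `1, m` but not
`2, 3`. -/
lemma card_two_three_eq {n r m : ℕ} (hr : 3 ≤ r) (hm : 4 ≤ m) (hmn : m ≤ n) :
    #{A ∈ uniformSets n r | 1 ∉ A ∧ Icc 2 3 ⊆ A} =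
      #{A ∈ uniformSets n r | (1 ∈ A ∧ m ∈ A) ∧ ¬ (A ∩ Icc 2 3).Nonempty} +
      #{A ∈ uniformSets n r | 1 ∉ A ∧ {2, 3, m} ⊆ A} := by
  have hS : ({1, 2, 3, m} : Finset ℕ) ⊆ Icc 1 n := by
    intro x
    simp only [mem_insert, mem_singleton, mem_Icc]
    omega
  have e1 : {A ∈ uniformSets n r | (1 ∈ A ∧ m ∈ A) ∧ ¬ (A ∩ Icc 2 3).Nonempty} =
      {A ∈ uniformSets n r | A ∩ {1, 2, 3, m} = {1, m}} := by
    refine filter_congr fun A _ => ?_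
    rw [not_nonempty_iff_eq_empty, Icc_two_three]
    simp only [Finset.ext_iff, mem_inter, mem_insert, mem_singleton, notMem_empty, iff_false]
    constructor
    · rintro ⟨⟨h1, h2⟩, h3⟩ x
      have := h3 x
      constructor
      · tauto
      · rintro (rfl | rfl) <;> simp [h1, h2]
    · intro h
      refine ⟨⟨((h 1).2 (by simp)).1, ((h m).2 (by simp)).1⟩, fun x hx => ?_⟩
      have := (h x).1 ⟨hx.1, by tauto⟩
      omega
  have e2 : {A ∈ uniformSets n r | (1 ∉ A ∧ Icc 2 3 ⊆ A) ∧ m ∉ A} =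
      {A ∈ uniformSets n r | A ∩ {1, 2, 3, m} = {2, 3}} := by
    refine filter_congr fun A _ => ?_
    simp only [Icc_two_three, Finset.ext_iff, mem_inter, mem_insert, mem_singleton,
      insert_subset_iff, singleton_subset_iff]
    constructor
    · rintro ⟨⟨h1, h2, h3⟩, h4⟩ x
      constructor
      · rintro ⟨hx, rfl | rfl | rfl | rfl⟩ <;> simp_all
      · rintro (rfl | rfl) <;> simp_all
    · intro h
      refine ⟨⟨fun h1 => ?_, ((h 2).2 (by simp)).1, ((h 3).2 (by simp)).1⟩, fun h1 => ?_⟩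
      · have := (h 1).1 ⟨h1, by simp⟩
        omega
      · have := (h m).1 ⟨h1, by simp⟩
        omega
  have e3 : {A ∈ uniformSets n r | 1 ∉ A ∧ {2, 3, m} ⊆ A} =
      {A ∈ uniformSets n r | (1 ∉ A ∧ Icc 2 3 ⊆ A) ∧ m ∈ A} := by
    refine filter_congr fun A _ => ?_
    simp only [Icc_two_three, insert_subset_iff, singleton_subset_iff]
    tauto
  have h := card_filter_add_card_filter_not
    (s := {A ∈ uniformSets n r | 1 ∉ A ∧ Icc 2 3 ⊆ A}) (fun A => m ∈ A)
  rw [filter_filter, filter_filter, e2, ← e3] at h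
  -- The traces $\{1,m\}$ and $\{2,3\}$ on $\{1,2,3,m\}$ have the same size, hence are taken by
  -- equally many sets.
  rw [← h, e1, card_filter_inter_eq hS, card_filter_inter_eq hS, card_pair, card_pair, add_comm]
  · omega
  · omega
  · intro x; simp only [mem_insert, mem_singleton]; omega
  · rw [card_pair] <;> omega
  · intro x; simp only [mem_insert, mem_singleton]; omega
  · rw [card_pair] <;> omega

/-- If `X` meets `{2, 3}` and `m` is its only other element, then `AHM n r 3` gains on the star
as many sets as there are sets above `{2, 3, m}` without `1`. -/
lemma hit_AHM_three_eq {n r m : ℕ} (hr : 3 ≤ r) (hm : 4 ≤ m) (hmn : m ≤ n) {X : Finset ℕ}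
    (hX : X \ {2, 3} = {m}) (hX' : (X ∩ {2, 3}).Nonempty) :
    hit X (AHM n r 3) =
      hit X (star1 n r) + #{A ∈ uniformSets n r | 1 ∉ A ∧ {2, 3, m} ⊆ A} := by
  have h := hit_star1_add (n := n) (r := r) (t := 3) (by omega) X
  have e1 : {A ∈ uniformSets n r | 1 ∉ A ∧ Icc 2 3 ⊆ A ∧ (A ∩ X).Nonempty} =
      {A ∈ uniformSets n r | 1 ∉ A ∧ Icc 2 3 ⊆ A} := by
    refine filter_congr fun A _ => ?_
    have : Icc 2 3 ⊆ A → (A ∩ X).Nonempty := fun h => by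
      obtain ⟨x, hx⟩ := hX'
      rw [mem_inter, ← Icc_two_three] at hx
      exact ⟨x, mem_inter.2 ⟨h hx.2, hx.1⟩⟩
    tauto
  have e2 : {A ∈ uniformSets n r | (1 ∈ A ∧ (A ∩ X).Nonempty) ∧ ¬ (A ∩ Icc 2 3).Nonempty} =
      {A ∈ uniformSets n r | (1 ∈ A ∧ m ∈ A) ∧ ¬ (A ∩ Icc 2 3).Nonempty} := by
    refine filter_congr fun A _ => and_congr_left fun hA => and_congr_right fun _ => ?_
    rw [Icc_two_three, not_nonempty_iff_eq_empty, ← disjoint_iff_inter_eq_empty] at hA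
    have hmX : m ∈ X := (mem_sdiff.1 (hX ▸ mem_singleton_self m)).1
    refine ⟨fun ⟨x, hx⟩ => ?_, fun h => ⟨m, mem_inter.2 ⟨h, hmX⟩⟩⟩
    rw [mem_inter] at hx
    have : x ∈ X \ {2, 3} := mem_sdiff.2 ⟨hx.2, disjoint_left.1 hA hx.1⟩
    rw [hX, mem_singleton] at this
    exact this ▸ hx.1
  rw [e1, e2, card_two_three_eq hr hm hmn] at h
  omega

lemma hit_star1_lt_hit_AHM_three {n r m : ℕ} (hr : 3 ≤ r) (hn : 2 * r ≤ n) (hm : 4 ≤ m)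
    (hmn : m ≤ n) {X : Finset ℕ} (hX : X \ {2, 3} = {m}) (hX' : (X ∩ {2, 3}).Nonempty) :
    hit X (star1 n r) < hit X (AHM n r 3) := by
  rw [hit_AHM_three_eq hr hm hmn hX hX']
  obtain ⟨B, hB, hS, hd⟩ := exists_uniformSet_disjoint (r := r) (S := {2, 3, m}) (A := {1}) hn
    (by intro x; simp only [mem_insert, mem_singleton, mem_Icc]; omega)
    (card_le_three.trans hr) (by simp; omega) (by simp; omega)
  exact Nat.lt_add_of_pos_right (card_pos.2 ⟨B, mem_filter.2 ⟨hB, by simpa using hd, hS⟩⟩)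

lemma subset_Icc_of_sdiff_eq {n m : ℕ} {X : Finset ℕ} (hX : X ⊆ Icc 2 n) (hm : 4 ≤ m)
    (h : X \ {2, 3} = {m}) : X ⊆ Icc 2 m := by
  intro x hx
  have h2 := mem_Icc_two_of_mem hX hx
  by_cases h3 : x ∈ X \ {2, 3}
  · rw [h, mem_singleton] at h3
    exact mem_Icc.2 (by omega)
  · simp [hx] at h3
    exact mem_Icc.2 (by omega)

lemma hit_AHM_four_eq {n r : ℕ} (hr : 3 ≤ r) (hn : 2 * r ≤ n) {X : Finset ℕ} (hXn : X ⊆ Icc 2 n)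
    (hX : X \ {2, 3} = {4}) (hX' : (X ∩ {2, 3}).Nonempty) :
    hit X (AHM n r 4) = hit X (AHM n r 3) := by
  rw [hit_AHM_three_eq hr le_rfl (by omega) hX hX', hit_AHM_eq_hit_star1_add (by omega)
    (subset_Icc_of_sdiff_eq hXn le_rfl hX) (hX'.mono inter_subset_left)]
  have : Icc 2 4 = ({2, 3, 4} : Finset ℕ) := by decide
  rw [this]

/-- The gains over the star are the sets without 1 above $[2,m]$ and above $\{2,3,m\}$ respectively.
For $m>4$ a set above $\{2,3,m\}$ avoiding 1 and 4 separates them. -/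
lemma hit_AHM_lt_hit_AHM_three {n r m : ℕ} (hr : 3 ≤ r) (hn : 2 * r ≤ n) (hm : 4 < m)
    (hmn : m ≤ n) {X : Finset ℕ} (hXn : X ⊆ Icc 2 n)
    (hX : X \ {2, 3} = {m}) (hX' : (X ∩ {2, 3}).Nonempty) :
    hit X (AHM n r m) < hit X (AHM n r 3) := by
  rw [hit_AHM_three_eq hr hm.le hmn hX hX', hit_AHM_eq_hit_star1_add (by omega)
    (subset_Icc_of_sdiff_eq hXn hm.le hX) (hX'.mono inter_subset_left), add_lt_add_iff_left]
  obtain ⟨B, hB, hS, hd⟩ := exists_uniformSet_disjoint (r := r) (S := {2, 3, m}) (A := {1, 4}) hn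
    (by intro x; simp only [mem_insert, mem_singleton, mem_Icc]; omega)
    (card_le_three.trans hr) (card_le_two.trans (by omega)) (by simp; omega)
  rw [disjoint_right] at hd
  refine card_lt_card ((Finset.ssubset_iff_of_subset (fun A hA => ?_)).2
    ⟨B, mem_filter.2 ⟨hB, hd (by simp), hS⟩, fun h => ?_⟩)
  · rw [mem_filter] at hA ⊢
    refine ⟨hA.1, hA.2.1, fun x hx => hA.2.2 ?_⟩
    simp only [mem_insert, mem_singleton] at hx
    exact mem_Icc.2 (by omega)
  · exact hd (by simp : 4 ∈ ({1, 4} : Finset ℕ))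
      ((mem_filter.1 h).2.2 (mem_Icc.2 (by omega)))

/-- In all other cases the star is better than `AHM n r 3`. -/
lemma hit_AHM_three_lt_hit_star1 {n r m : ℕ} (hr : 3 ≤ r) (hn : IsLarge n r) {X : Finset ℕ}
    (hXn : X ⊆ Icc 2 n) (hm : m ∈ X \ {2, 3})
    (hX : ¬ (X \ {2, 3} = {m} ∧ (X ∩ {2, 3}).Nonempty)) :
    hit X (AHM n r 3) < hit X (star1 n r) := by
  have hn' := hn.1
  have hmem : ∀ x ∈ X \ {2, 3}, x ∈ X ∧ 4 ≤ x ∧ x ≤ n := fun x hx => by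
    rw [mem_sdiff] at hx
    have := mem_Icc_two_of_mem hXn hx.1
    simp only [mem_insert, mem_singleton] at hx
    exact ⟨hx.1, by omega⟩
  obtain ⟨hmX, hm4, hmn⟩ := hmem m hm
  have hR : ({2, 3, m} : Finset ℕ) ⊆ Icc 1 n := by
    intro x; simp only [mem_insert, mem_singleton, mem_Icc]; omega
  have hR3 : #({2, 3, m} : Finset ℕ) = 3 := by
    rw [card_eq_three]; exact ⟨2, 3, m, by omega, by omega, by omega, rfl⟩
  have hWR : #{A ∈ uniformSets n r | 1 ∉ A ∧ {2, 3, m} ⊆ A} ≤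
      #{A ∈ uniformSets n r | {2, 3, m} ⊆ A} :=
    card_le_card (monotone_filter_right _ fun _ _ h => h.2)
  have h := hit_star1_add (n := n) (r := r) (t := 3) (by omega) X
  have hU : {A ∈ uniformSets n r | (1 ∈ A ∧ m ∈ A) ∧ ¬ (A ∩ Icc 2 3).Nonempty} ⊆
      {A ∈ uniformSets n r | (1 ∈ A ∧ (A ∩ X).Nonempty) ∧ ¬ (A ∩ Icc 2 3).Nonempty} :=
    monotone_filter_right _ fun _ _ h => ⟨⟨h.1.1, m, mem_inter.2 ⟨h.1.2, hmX⟩⟩, h.2⟩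
  -- If $X=\{m\}$, the gain lies above the triple $\{2,3,m\}$, while the loss includes all sets of
  -- trace $\{1,m\}$ on $\{1,2,3,m\}$.
  by_cases hXm : X \ {2, 3} = {m}
  · have hXe : X = {m} := by
      have h2 : ¬ (X ∩ {2, 3}).Nonempty := fun h => hX ⟨hXm, h⟩
      rw [not_nonempty_iff_eq_empty, ← disjoint_iff_inter_eq_empty] at h2
      rwa [sdiff_eq_self_of_disjoint h2] at hXm
    have hV : {A ∈ uniformSets n r | 1 ∉ A ∧ Icc 2 3 ⊆ A ∧ (A ∩ X).Nonempty} ⊆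
        {A ∈ uniformSets n r | {2, 3, m} ⊆ A} := by
      refine monotone_filter_right _ fun A _ h => ?_
      rw [hXe, inter_singleton_nonempty_iff, Icc_two_three] at h
      have h' := h.2.1
      simp only [insert_subset_iff, singleton_subset_iff] at h' ⊢
      exact ⟨h'.1, h'.2, h.2.2⟩
    have hlt := hn.card_superset_lt_card_filter_inter_eq hr hR hR3 (S := {1, 2, 3, m}) (T := {1, m})
      (by intro x; simp only [mem_insert, mem_singleton, mem_Icc]; omega)
      (card_le_four.trans (by omega))
      (by intro x; simp only [mem_insert, mem_singleton]; omega) (card_pair (by omega))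
    have hU' : {A ∈ uniformSets n r | A ∩ {1, 2, 3, m} = {1, m}} ⊆
        {A ∈ uniformSets n r | (1 ∈ A ∧ m ∈ A) ∧ ¬ (A ∩ Icc 2 3).Nonempty} := by
      refine monotone_filter_right _ fun A _ h => ?_
      simp only [Finset.ext_iff, mem_inter, mem_insert, mem_singleton] at h
      refine ⟨⟨((h 1).2 (by simp)).1, ((h m).2 (by simp)).1⟩, fun ⟨x, hx⟩ => ?_⟩
      rw [mem_inter, mem_Icc] at hx
      have := (h x).1 ⟨hx.1, by omega⟩
      omega
    have := card_le_card hV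
    have := card_le_card (hU'.trans hU)
    omega
  -- The losses through $m$ cancel the gain up to sets above $\{2,3,m\}$; the further losses through
  -- a second element $p$, without $m$, outweigh these.
  · obtain ⟨p, hp, hpm⟩ : ∃ p ∈ X \ {2, 3}, p ≠ m := by
      by_contra! hall
      exact hXm (eq_singleton_iff_unique_mem.2 ⟨hm, hall⟩)
    obtain ⟨hpX, hp4, hpn⟩ := hmem p hp
    have hV : {A ∈ uniformSets n r | 1 ∉ A ∧ Icc 2 3 ⊆ A ∧ (A ∩ X).Nonempty} ⊆
        {A ∈ uniformSets n r | 1 ∉ A ∧ Icc 2 3 ⊆ A} :=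
      monotone_filter_right _ fun _ _ h => ⟨h.1, h.2.1⟩
    have hlt := hn.card_superset_lt_card_filter_inter_eq hr hR hR3
      (S := insert m {1, 2, 3, p}) (T := {1, p})
      (by intro x; simp only [mem_insert, mem_singleton, mem_Icc]; omega)
      (((card_insert_le _ _).trans (Nat.succ_le_succ card_le_four)).trans (by omega))
      (by intro x; simp only [mem_insert, mem_singleton]; omega) (card_pair (by omega))
    have hUp : {A ∈ uniformSets n r | A ∩ insert m {1, 2, 3, p} = {1, p}} ⊆
        {A ∈ uniformSets n r | (1 ∈ A ∧ (A ∩ X).Nonempty) ∧ ¬ (A ∩ Icc 2 3).Nonempty} := by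
      refine monotone_filter_right _ fun A _ h => ?_
      simp only [Finset.ext_iff, mem_inter, mem_insert, mem_singleton] at h
      refine ⟨⟨((h 1).2 (by simp)).1, p, mem_inter.2 ⟨((h p).2 (by simp)).1, hpX⟩⟩,
        fun ⟨x, hx⟩ => ?_⟩
      rw [mem_inter, mem_Icc] at hx
      have := (h x).1 ⟨hx.1, by omega⟩
      omega
    have hdisj : Disjoint
        {A ∈ uniformSets n r | (1 ∈ A ∧ m ∈ A) ∧ ¬ (A ∩ Icc 2 3).Nonempty}
        {A ∈ uniformSets n r | A ∩ insert m {1, 2, 3, p} = {1, p}} := by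
      refine disjoint_filter.2 fun A _ h h' => ?_
      have : m ∈ A ∩ insert m {1, 2, 3, p} := mem_inter.2 ⟨h.1.2, mem_insert_self _ _⟩
      rw [h'] at this
      simp only [mem_insert, mem_singleton] at this
      omega
    have h7 := card_le_card (union_subset hU hUp)
    rw [card_union_of_disjoint hdisj] at h7
    have h8 := card_le_card hV
    rw [card_two_three_eq hr hm4 hmn] at h8
    omega

/-! ### The optimal families. -/

lemma setOf_isOptimalFor_eq_singleton {n r : ℕ} {X : Finset ℕ} {G : Finset (Finset ℕ)}
    (hG : IsMLCIF n r G) (h : ∀ F, IsMLCIF n r F → F ≠ G → hit X F < hit X G) :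
    {F | IsOptimalFor n r X F} = {G} := by
  ext F
  simp only [Set.mem_ofPred_eq, Set.mem_singleton_iff]
  constructor
  · intro hF
    by_contra hne
    exact (h F hF.1 hne).not_ge (hF.2 G hG)
  · rintro rfl
    refine ⟨hG, fun F' hF' => ?_⟩
    by_cases hne : F' = F
    · rw [hne]
    · exact (h F' hF' hne).le

lemma setOf_isOptimalFor_eq_pair {n r : ℕ} {X : Finset ℕ} {G H : Finset (Finset ℕ)}
    (hG : IsMLCIF n r G) (hH : IsMLCIF n r H) (hGH : hit X H = hit X G)
    (h : ∀ F, IsMLCIF n r F → F ≠ G → F ≠ H → hit X F < hit X G) :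
    {F | IsOptimalFor n r X F} = {G, H} := by
  have hle : ∀ F, IsMLCIF n r F → hit X F ≤ hit X G := fun F hF => by
    by_cases hFG : F = G
    · rw [hFG]
    by_cases hFH : F = H
    · rw [hFH, hGH]
    exact (h F hF hFG hFH).le
  ext F
  simp only [Set.mem_ofPred_eq, Set.mem_insert_iff, Set.mem_singleton_iff]
  constructor
  · intro hF
    by_contra! hne
    exact (h F hF.1 hne.1 hne.2).not_ge (hF.2 G hG)
  · rintro (rfl | rfl)
    · exact ⟨hG, hle⟩
    · exact ⟨hH, fun F' hF' => hGH ▸ hle F' hF'⟩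

/-- The optimal families for a set meeting `{2, 3}` with exactly one further element. -/
lemma setOf_isOptimalFor_of_sdiff_eq {n r m : ℕ} (hr : 3 ≤ r) (hn : IsLarge n r) {X : Finset ℕ}
    (hXn : X ⊆ Icc 2 n) (hX : X \ {2, 3} = {m}) (hX' : (X ∩ {2, 3}).Nonempty) :
    (m ≠ 4 → {F | IsOptimalFor n r X F} = {AHM n r 3}) ∧
    (m = 4 → {F | IsOptimalFor n r X F} = {AHM n r 3, AHM n r 4}) := by
  have hn' := hn.1
  have hn2 : 2 * r ≤ n := by omega
  have hmX := mem_sdiff.1 (hX ▸ mem_singleton_self m)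
  have hmn := mem_Icc_two_of_mem hXn hmX.1
  have hm4 : 4 ≤ m := by
    have := hmX.2
    simp only [mem_insert, mem_singleton] at this
    omega
  have hXm := subset_Icc_of_sdiff_eq hXn hm4 hX
  have hA3 := isMLCIF_AHM hr hn2 le_rfl (by omega : 3 ≤ r + 1)
  refine ⟨fun h4 => setOf_isOptimalFor_eq_singleton hA3 fun F hF hF3 => ?_, ?_⟩
  -- The intermediate competitor is $\mathrm{AHM}_m$ when $m\le r+1$ and the star otherwise; both
  -- lose to $\mathrm{AHM}_3$.
  · by_cases hmr : m ≤ r + 1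
    · have hlt : hit X (AHM n r m) < hit X (AHM n r 3) :=
        hit_AHM_lt_hit_AHM_three hr hn2 (by omega) hmn.2 hXn hX hX'
      by_cases hFm : F = AHM n r m
      · rwa [hFm]
      · exact (hF.hit_lt_hit_AHM hr hn hXm hmX.1 (by omega) hmr hF3 hFm).trans hlt
    · have hlt := hit_star1_lt_hit_AHM_three hr hn2 hm4 hmn.2 hX hX'
      by_cases h1 : F = star1 n r
      · rwa [h1]
      · refine (hF.hit_lt_hit_star1_of_not_subset hr hn h1 hF3 hXn fun h => hmr ?_).trans hlt
        exact (mem_Icc.1 (h hmX.1)).2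
  · rintro rfl
    have heq := hit_AHM_four_eq hr hn2 hXn hX hX'
    refine setOf_isOptimalFor_eq_pair hA3 (isMLCIF_AHM hr hn2 (by omega) (by omega)) heq
      fun F hF hF3 hF4 => ?_
    rw [← heq]
    exact hF.hit_lt_hit_AHM hr hn hXm hmX.1 (by omega) (by omega) hF3 hF4

lemma setOf_isOptimalFor_of_max_eq_three {n r : ℕ} (hr : 3 ≤ r) (hn : IsLarge n r) {X : Finset ℕ}
    (hX : X ⊆ {2, 3}) (h3 : 3 ∈ X) : {F | IsOptimalFor n r X F} = {AHM n r 3} :=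
  setOf_isOptimalFor_eq_singleton
    (isMLCIF_AHM hr (by linarith [hn.1]) le_rfl (by omega)) fun F hF hF3 =>
      hF.hit_lt_hit_AHM hr hn (by rwa [Icc_two_three]) h3 le_rfl (by omega) hF3 hF3

theorem theorem1p4 (r : ℕ) (hr : 3 ≤ r) :
    ∃ N : ℕ, ∀ n : ℕ, N ≤ n → ∀ X : Finset ℕ, X ⊆ Icc 2 n → ∀ hX : X.Nonempty,
      -- (a)
      (X = {2} → {F | IsOptimalFor n r X F} = {AHM n r 3}) ∧
      -- (b)
      (#X = 2 → (X ∩ {2, 3}).Nonempty →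
        (4 ∉ X → {F | IsOptimalFor n r X F} = {AHM n r 3}) ∧
        (4 ∈ X → {F | IsOptimalFor n r X F} = {AHM n r 3, AHM n r 4})) ∧
      -- (c)
      (#X = 3 → {2, 3} ⊆ X →
        (X ≠ {2, 3, 4} → {F | IsOptimalFor n r X F} = {AHM n r 3}) ∧
        (X = {2, 3, 4} → {F | IsOptimalFor n r X F} = {AHM n r 3, AHM n r 4})) ∧
      -- (d) and all remaining sets
      (X ≠ {2} → ¬ (#X = 2 ∧ (X ∩ {2, 3}).Nonempty) → ¬ (#X = 3 ∧ {2, 3} ⊆ X) →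
        (X ⊆ Icc 2 (r + 1) → {F | IsOptimalFor n r X F} = {AHM n r (X.max' hX)}) ∧
        (¬ X ⊆ Icc 2 (r + 1) → {F | IsOptimalFor n r X F} = {star1 n r})) := by
  obtain ⟨N, hN⟩ := exists_forall_isLarge hr
  refine ⟨N, fun n hNn X hXn hX => ?_⟩
  have hn := hN n hNn
  have hn2 : 2 * r ≤ n := by linarith [hn.1]
  have hcard := card_sdiff_add_card_inter X {2, 3}
  have hinter : #(X ∩ {2, 3}) ≤ 2 := (card_le_card inter_subset_right).trans card_le_two
  have hinter2 : #(X ∩ {2, 3}) = 2 → {2, 3} ⊆ X := fun h =>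
    inter_eq_right.1 (eq_of_subset_of_card_le inter_subset_right (card_le_two.trans h.ge))
  refine ⟨?_, ?_, ?_, ?_⟩
  · rintro rfl
    exact setOf_isOptimalFor_eq_singleton (isMLCIF_AHM hr hn2 le_rfl (by omega))
      fun F hF hF3 => hF.hit_singleton_two_lt hr hn hF3
  · intro h2 hne
    have hpos := card_pos.2 hne
    obtain h | h : #(X ∩ {2, 3}) = 1 ∨ #(X ∩ {2, 3}) = 2 := by omega
    · obtain ⟨m, hm⟩ := card_eq_one.1 (by omega : #(X \ {2, 3}) = 1)
      have hm4 : 4 ∈ X ↔ m = 4 := by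
        have : 4 ∈ X ↔ 4 ∈ X \ {2, 3} := by simp
        rw [this, hm, mem_singleton, eq_comm]
      rw [hm4]
      exact setOf_isOptimalFor_of_sdiff_eq hr hn hXn hm hne
    · have hXe : {2, 3} = X := eq_of_subset_of_card_le (hinter2 h) (by rw [h2]; decide)
      subst hXe
      exact ⟨fun _ => setOf_isOptimalFor_of_max_eq_three hr hn subset_rfl (by simp),
        fun h => absurd h (by decide)⟩
  · intro h3 hsub
    rw [inter_eq_right.2 hsub, card_pair (by omega)] at hcard
    obtain ⟨m, hm⟩ := card_eq_one.1 (by omega : #(X \ {2, 3}) = 1)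
    have hXe : X = {2, 3, m} := by
      rw [← sdiff_union_of_subset hsub, hm, union_comm]
      rfl
    have hm4 : X = {2, 3, 4} ↔ m = 4 := by
      constructor
      · intro h
        have : 4 ∈ X \ {2, 3} := by simp [h]
        rw [hm, mem_singleton] at this
        exact this.symm
      · rintro rfl
        exact hXe
    rw [ne_eq, hm4]
    exact setOf_isOptimalFor_of_sdiff_eq hr hn hXn hm (by rw [inter_eq_right.2 hsub]; simp)
  · intro ha hb hc
    -- Apart from $X=\{2,3\}$, cases (b) and (c) are exactly the sets meeting $\{2,3\}$ with one
    -- element outside it.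
    have hspecial : ∀ m, ¬ (X \ {2, 3} = {m} ∧ (X ∩ {2, 3}).Nonempty) := by
      rintro m ⟨hm, hne⟩
      have hpos := card_pos.2 hne
      rw [hm, card_singleton] at hcard
      obtain h | h : #(X ∩ {2, 3}) = 1 ∨ #(X ∩ {2, 3}) = 2 := by omega
      · exact hb ⟨by omega, hne⟩
      · exact hc ⟨by omega, hinter2 h⟩
    refine ⟨fun hXr => ?_, fun hXr => ?_⟩
    -- With (a) and (b) excluded, this leaves only $X=\{3\}$.
    · by_cases hempty : X ⊆ {2, 3}
      · have h3 : 3 ∈ X := by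
          by_contra h3
          refine ha ((subset_singleton_iff.1 fun x hx => ?_).resolve_left hX.ne_empty)
          have := hempty hx
          simp only [mem_insert, mem_singleton] at this ⊢
          rcases this with h | rfl
          · exact h
          · exact absurd hx h3
        have hmax : X.max' hX = 3 := by
          refine le_antisymm (max'_le _ _ _ fun x hx => ?_) (le_max' _ _ h3)
          have := hempty hx
          simp only [mem_insert, mem_singleton] at this
          omega
        rw [hmax]
        exact setOf_isOptimalFor_of_max_eq_three hr hn hempty h3
      · obtain ⟨m, hm⟩ := sdiff_nonempty.2 hempty
        have hm4 : 4 ≤ X.max' hX := by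
          rw [mem_sdiff] at hm
          have h1 := mem_Icc_two_of_mem hXn hm.1
          have h2 := le_max' X m hm.1
          simp only [mem_insert, mem_singleton] at hm
          omega
        have hmr := mem_Icc.1 (hXr (max'_mem X hX))
        have hXm : X ⊆ Icc 2 (X.max' hX) := fun x hx =>
          mem_Icc.2 ⟨(mem_Icc_two_of_mem hXn hx).1, le_max' X x hx⟩
        refine setOf_isOptimalFor_eq_singleton (isMLCIF_AHM hr hn2 (by omega) hmr.2)
          fun F hF hne => ?_
        by_cases hF3 : F = AHM n r 3
        · rw [hF3]
          exact (hit_AHM_three_lt_hit_star1 hr hn hXn hm (hspecial m)).trans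
            (hit_star1_lt_hit_AHM hr hn2 hXm (max'_mem X hX) (by omega) hmr.2)
        · exact hF.hit_lt_hit_AHM hr hn hXm (max'_mem X hX) (by omega) hmr.2 hF3 hne
    · obtain ⟨m, hm⟩ : (X \ {2, 3}).Nonempty := by
        refine sdiff_nonempty.2 fun h => hXr (h.trans ?_)
        rw [← Icc_two_three]
        exact Icc_subset_Icc_right (by omega)
      refine setOf_isOptimalFor_eq_singleton (isMLCIF_star1 hr hn2) fun F hF hne => ?_
      by_cases hF3 : F = AHM n r 3
      · rw [hF3]
        exact hit_AHM_three_lt_hit_star1 hr hn hXn hm (hspecial m)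
      · exact hF.hit_lt_hit_star1_of_not_subset hr hn hne hF3 hXn hXr
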